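/- Let $(X,d_X)$ be a geodesic Gromov hyperbolic metric space, let $G$ be a group acting on $X$ by isometries, and let $\mathcal Y$ be a $G$-invariant collection of subsets of $X$ (that is, $gY\in\mathcal Y$ for all $g\in G$, $Y\in\mathcal Y$) which is uniformly quasiconvex: there is a constant $Q$ such that for every $Y\in\mathcal Y$, every geodesic of $X$ with endpoints in $Y$ is contained in the $Q$-neighbourhood of $Y$. Let $X_{\mathcal Y}$ be the electrification of $X$ along $\mathcal Y$, i.e. the metric space obtained from $X$ by adding a cone vertex $v_Y$ for each (nonempty) $Y\in\mathcal Y$ and attaching an edge of length $\tfrac12$ from each $y\in Y$ to $v_Y$, with the induced path metric. The group $G$ acts on $X_{\mathcal Y}$ by isometries. An element $g$ of a group acting by isometries on a metric space $(Z,d_Z)$ acts *loxodromically* on $Z$ if its translation length $\lim_{n\to\infty}\frac1n d_Z(z_0,g^nz_0)$, which does not depend on $z_0 \in Z$, is positive. We say that $G$ acts *loxodromically on* a subset $Y\subseteq X$ if $G$ contains an element $g$ that acts loxodromically on $X$ and has a quasi-axis (a $g$-invariant bi-infinite quasigeodesic in $X$) contained in a bounded neighbourhood of $Y$. Suppose that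 $X_{\mathcal Y}$ has infinite diameter, that $G$ acts on $X_{\mathcal Y}$ with unbounded orbits, and that $G$ acts loxodromically on some $Y\in\mathcal Y$. Then $G$ contains an element which acts loxodromically on $X_{\mathcal Y}$. -/

import Mathlib

open Filter Topology
open scoped Pointwise

/-- `γ`, restricted to `[0, dist x y]`, is a geodesic segment from `x` to `y`. -/
def IsGeodesicSegment {X : Type*} [MetricSpace X] (γ : ℝ → X) (x y : X) : Prop :=
  γ 0 = x ∧ γ (dist x y) = y ∧
    ∀ s ∈ Set.Icc 0 (dist x y), ∀ t ∈ Set.Icc 0 (dist x y), dist (γ s) (γ t) = |s - t|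

/-- Any two points are joined by a geodesic segment. -/
def IsGeodesicSpace (X : Type*) [MetricSpace X] : Prop :=
  ∀ x y : X, ∃ γ : ℝ → X, IsGeodesicSegment γ x y

/-- The Gromov product `(x | y)_w`. -/
noncomputable def gromovProduct {X : Type*} [MetricSpace X] (w x y : X) : ℝ :=
  (dist w x + dist w y - dist x y) / 2

/-- Gromov hyperbolicity: `(x | z)_w ≥ min ((x | y)_w) ((y | z)_w) - δ` for some constant `δ`. -/
def IsGromovHyperbolic (X : Type*) [MetricSpace X] : Prop :=
  ∃ δ : ℝ, ∀ w x y z : X,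
    min (gromovProduct w x y) (gromovProduct w y z) - δ ≤ gromovProduct w x z

/-- `Y` is `Q`-quasiconvex: every geodesic between points of `Y` is contained in the
`Q`-neighbourhood of `Y`. -/
def IsQuasiconvexSubset {X : Type*} [MetricSpace X] (Q : ℝ) (Y : Set X) : Prop :=
  ∀ x ∈ Y, ∀ y ∈ Y, ∀ γ : ℝ → X, IsGeodesicSegment γ x y →
    ∀ t ∈ Set.Icc 0 (dist x y), ∃ z ∈ Y, dist (γ t) z ≤ Q

/-- The members of `𝒴` are uniformly quasiconvex. -/
def UniformlyQuasiconvex {X : Type*} [MetricSpace X] (𝒴 : Set (Set X)) : Prop :=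
  ∃ Q : ℝ, ∀ Y ∈ 𝒴, IsQuasiconvexSubset Q Y

/-- The family `𝒴` of subsets of `X` is invariant under the action of `G`. -/
class InvariantFamily (G : Type*) {X : Type*} [Group G] [MulAction G X]
    (𝒴 : Set (Set X)) : Prop where
  smul_mem : ∀ (g : G) (Y : Set X), Y ∈ 𝒴 → g • Y ∈ 𝒴

/-- The underlying set of the electrification of `X` along `𝒴`: the points of `X`; one cone vertex
for each (nonempty) `Y ∈ 𝒴`; and, for each `y ∈ Y ∈ 𝒴`, the interior points of an edge of length
`1/2` from `y` to the cone vertex of `Y`, where `t` is the distance along the edge from `y`. -/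
inductive Electrification {X : Type*} (𝒴 : Set (Set X))
  | base (x : X) : Electrification 𝒴
  | cone (Y : Set X) (hY : Y ∈ 𝒴) (hne : Y.Nonempty) : Electrification 𝒴
  | edge (Y : Set X) (hY : Y ∈ 𝒴) (y : X) (hy : y ∈ Y) (t : ℝ) (h0 : 0 < t) (h1 : t < 1 / 2) :
      Electrification 𝒴

namespace Electrification

/-- `Step p q a`: the points `p` and `q` lie in `X`, or on one (closed) edge, and `a` is their
distance there. -/
inductive Step {X : Type*} [MetricSpace X] {𝒴 : Set (Set X)} :
    Electrification 𝒴 → Electrification 𝒴 → ℝ → Prop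
  | inBase (x y : X) : Step (base x) (base y) (dist x y)
  | baseEdge (Y : Set X) (hY : Y ∈ 𝒴) (y : X) (hy : y ∈ Y) (t : ℝ) (h0 : 0 < t) (h1 : t < 1 / 2) :
      Step (base y) (edge Y hY y hy t h0 h1) t
  | inEdge (Y : Set X) (hY : Y ∈ 𝒴) (y : X) (hy : y ∈ Y) (s : ℝ) (hs0 : 0 < s) (hs1 : s < 1 / 2)
      (t : ℝ) (ht0 : 0 < t) (ht1 : t < 1 / 2) :
      Step (edge Y hY y hy s hs0 hs1) (edge Y hY y hy t ht0 ht1) |s - t|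
  | edgeCone (Y : Set X) (hY : Y ∈ 𝒴) (y : X) (hy : y ∈ Y) (t : ℝ) (h0 : 0 < t) (h1 : t < 1 / 2)
      (hne : Y.Nonempty) : Step (edge Y hY y hy t h0 h1) (cone Y hY hne) (1 / 2 - t)
  | baseCone (Y : Set X) (hY : Y ∈ 𝒴) (y : X) (hy : y ∈ Y) (hne : Y.Nonempty) :
      Step (base y) (cone Y hY hne) (1 / 2)
  | symm {p q : Electrification 𝒴} {a : ℝ} : Step p q a → Step q p a

/-- `HasPath p q a`: there is a finite chain of steps from `p` to `q` of total length `a`. -/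
inductive HasPath {X : Type*} [MetricSpace X] {𝒴 : Set (Set X)} :
    Electrification 𝒴 → Electrification 𝒴 → ℝ → Prop
  | refl (p : Electrification 𝒴) : HasPath p p 0
  | cons {p q r : Electrification 𝒴} {a b : ℝ} :
      Step p q a → HasPath q r b → HasPath p r (a + b)

section metric

variable {X : Type*} [MetricSpace X] {𝒴 : Set (Set X)}

theorem Step.nonneg {p q : Electrification 𝒴} {a : ℝ} (h : Step p q a) : 0 ≤ a := by
  induction h with
  | inBase x y => exact dist_nonneg
  | baseEdge Y hY y hy t h0 h1 => exact h0.le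
  | inEdge => exact abs_nonneg _
  | edgeCone Y hY y hy t h0 h1 hne => linarith
  | baseCone => norm_num
  | symm _ ih => exact ih

theorem HasPath.nonneg {p q : Electrification 𝒴} {a : ℝ} (h : HasPath p q a) : 0 ≤ a := by
  induction h with
  | refl => exact le_rfl
  | cons h _ ih => exact add_nonneg h.nonneg ih

theorem Step.hasPath {p q : Electrification 𝒴} {a : ℝ} (h : Step p q a) : HasPath p q a := by
  simpa using HasPath.cons h (HasPath.refl q)

theorem HasPath.trans {p q r : Electrification 𝒴} {a b : ℝ} (h : HasPath p q a)
    (h' : HasPath q r b) : HasPath p r (a + b) := by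
  induction h with
  | refl => simpa using h'
  | cons hs _ ih => rw [add_assoc]; exact HasPath.cons hs (ih h')

theorem HasPath.symm {p q : Electrification 𝒴} {a : ℝ} (h : HasPath p q a) : HasPath q p a := by
  induction h with
  | refl p => exact HasPath.refl p
  | cons hs _ ih => rw [add_comm]; exact ih.trans hs.symm.hasPath

theorem exists_hasPath_base (p : Electrification 𝒴) :
    ∃ (x : X) (a : ℝ), HasPath p (base x) a := by
  cases p with
  | base x => exact ⟨x, 0, HasPath.refl _⟩
  | cone Y hY hne =>
    obtain ⟨y, hy⟩ := id hne
    exact ⟨y, _, (Step.baseCone Y hY y hy hne).symm.hasPath⟩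
  | edge Y hY y hy t h0 h1 => exact ⟨y, _, (Step.baseEdge Y hY y hy t h0 h1).symm.hasPath⟩

theorem exists_hasPath (p q : Electrification 𝒴) : ∃ a : ℝ, HasPath p q a := by
  obtain ⟨x, a, ha⟩ := exists_hasPath_base p
  obtain ⟨y, b, hb⟩ := exists_hasPath_base q
  exact ⟨_, (ha.trans (Step.inBase x y).hasPath).trans hb.symm⟩

/-- The electrified distance: the infimum of the lengths of paths. -/
noncomputable instance : Dist (Electrification 𝒴) where
  dist p q := sInf {a : ℝ | HasPath p q a}

theorem dist_le_of_hasPath {p q : Electrification 𝒴} {a : ℝ} (h : HasPath p q a) :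
    dist p q ≤ a :=
  csInf_le ⟨0, fun _ hb => HasPath.nonneg hb⟩ h

theorem le_dist_of_forall {p q : Electrification 𝒴} {c : ℝ}
    (h : ∀ a, HasPath p q a → c ≤ a) : c ≤ dist p q :=
  le_csInf (exists_hasPath p q) h

theorem sub_le_dist (F : Electrification 𝒴 → ℝ)
    (hF : ∀ p q a, Step p q a → |F p - F q| ≤ a) (p q : Electrification 𝒴) :
    F q - F p ≤ dist p q := by
  refine le_dist_of_forall fun a h => ?_
  induction h with
  | refl => simp
  | cons hs _ ih =>
    have := (abs_le.1 (hF _ _ _ hs)).1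
    linarith

open Classical in
theorem eq_of_dist_eq_zero' (p q : Electrification 𝒴) (h : dist p q = 0) : p = q := by
  cases p with
  | base x =>
    let F : Electrification 𝒴 → ℝ := fun r => match r with
      | base z => min (dist x z) (1 / 2)
      | cone _ _ _ => 1 / 2
      | edge _ _ y _ t _ _ => min (dist x y + t) (1 / 2)
    have hF : ∀ p q a, Step p q a → |F p - F q| ≤ a := by
      intro p q a hs
      induction hs with
      | inBase u v =>
        have h1 := dist_triangle x u v
        have h2 := dist_triangle x v u
        rw [dist_comm v u] at h2
        have := dist_nonneg (x := u) (y := v)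
        simp only [F, min_def, abs_le]
        split_ifs <;> constructor <;> linarith
      | baseEdge Y hY y hy t h0 h1 =>
        simp only [F, min_def, abs_le]
        split_ifs <;> constructor <;> linarith
      | inEdge Y hY y hy s hs0 hs1 t ht0 ht1 =>
        have h1 := le_abs_self (s - t)
        have h2 := neg_le_abs (s - t)
        rw [abs_le]
        simp only [F, min_def]
        split_ifs <;> constructor <;> linarith
      | edgeCone Y hY y hy t h0 h1 hne =>
        have := dist_nonneg (x := x) (y := y)
        simp only [F, min_def, abs_le]
        split_ifs <;> constructor <;> linarith
      | baseCone Y hY y hy hne =>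
        have := dist_nonneg (x := x) (y := y)
        simp only [F, min_def, abs_le]
        split_ifs <;> constructor <;> linarith
      | symm _ ih => rwa [abs_sub_comm]
    have key := sub_le_dist F hF (base x) q
    rw [h] at key
    cases q with
    | base z =>
      simp only [F, dist_self, min_def] at key
      have : dist x z = 0 := le_antisymm (by split_ifs at key <;> linarith) dist_nonneg
      rw [dist_eq_zero.1 this]
    | cone =>
      simp only [F, dist_self] at key
      norm_num at key
    | edge Y hY y hy t h0 h1 =>
      have := dist_nonneg (x := x) (y := y)
      simp only [F, dist_self, min_def] at key
      split_ifs at key <;> linarith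
  | cone Y hY hne =>
    let F : Electrification 𝒴 → ℝ := fun r => match r with
      | base _ => 1 / 2
      | cone Z _ _ => if Z = Y then 0 else 1 / 2
      | edge Z _ _ _ t _ _ => if Z = Y then 1 / 2 - t else 1 / 2
    have hF : ∀ p q a, Step p q a → |F p - F q| ≤ a := by
      intro p q a hs
      induction hs with
      | inBase u v => simp only [F]; simp
      | baseEdge =>
        simp only [F, abs_le]
        split_ifs <;> constructor <;> linarith
      | inEdge Z hZ z hz s hs0 hs1 t ht0 ht1 =>
        have h1 := le_abs_self (s - t)
        have h2 := neg_le_abs (s - t)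
        rw [abs_le]
        simp only [F]
        split_ifs <;> constructor <;> linarith
      | edgeCone =>
        simp only [F, abs_le]
        split_ifs <;> constructor <;> linarith
      | baseCone =>
        simp only [F, abs_le]
        split_ifs <;> constructor <;> linarith
      | symm _ ih => rwa [abs_sub_comm]
    have key := sub_le_dist F hF (cone Y hY hne) q
    rw [h] at key
    cases q with
    | base z => simp only [F] at key; norm_num at key
    | cone Z hZ hne' =>
      by_cases hZY : Z = Y
      · subst hZY; rfl
      · simp only [F, if_neg hZY] at key; norm_num at key
    | edge Z hZ z hz t ht0 ht1 =>
      simp only [F, if_true] at key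
      split_ifs at key <;> linarith
  | edge Y hY y hy s hs0 hs1 =>
    let F : Electrification 𝒴 → ℝ := fun r => match r with
      | base _ => min s (1 / 2 - s)
      | cone _ _ _ => min s (1 / 2 - s)
      | edge Z _ z _ t _ _ =>
        if Z = Y ∧ z = y then min |t - s| (min s (1 / 2 - s)) else min s (1 / 2 - s)
    have hm1 : min s (1 / 2 - s) ≤ s := min_le_left _ _
    have hm2 : min s (1 / 2 - s) ≤ 1 / 2 - s := min_le_right _ _
    have hm0 : 0 < min s (1 / 2 - s) := lt_min hs0 (by linarith)
    have hF : ∀ p q a, Step p q a → |F p - F q| ≤ a := by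
      intro p q a hs
      induction hs with
      | inBase u v => simp only [F]; simp
      | baseEdge Z hZ z hz t ht0 ht1 =>
        have h2 := neg_le_abs (t - s)
        have h1 := le_abs_self (t - s)
        rw [abs_le]
        simp only [F, min_def |t - s|]
        split_ifs <;> constructor <;> linarith
      | inEdge Z hZ z hz u hu0 hu1 t ht0 ht1 =>
        have h1 := abs_sub_abs_le_abs_sub (u - s) (t - s)
        have h2 := abs_sub_abs_le_abs_sub (t - s) (u - s)
        rw [sub_sub_sub_cancel_right] at h1 h2
        rw [abs_sub_comm t u] at h2
        have h3 := abs_nonneg (u - t)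
        rw [abs_le]
        simp only [F, min_def |t - s|, min_def |u - s|]
        split_ifs <;> constructor <;> linarith
      | edgeCone Z hZ z hz t ht0 ht1 =>
        have h2 := neg_le_abs (t - s)
        have h1 := le_abs_self (t - s)
        rw [abs_le]
        simp only [F, min_def |t - s|]
        split_ifs <;> constructor <;> linarith
      | baseCone => simp only [F]; simp
      | symm _ ih => rwa [abs_sub_comm]
    have key := sub_le_dist F hF (edge Y hY y hy s hs0 hs1) q
    rw [h] at key
    simp only [F, sub_self, abs_zero, and_self, if_true, min_eq_left hm0.le, sub_zero] at key
    cases q with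
    | base z => exact absurd key (not_le.2 hm0)
    | cone Z hZ hne' => exact absurd key (not_le.2 hm0)
    | edge Z hZ z hz t ht0 ht1 =>
      by_cases hZY : Z = Y ∧ z = y
      · obtain ⟨rfl, rfl⟩ := hZY
        simp only [and_self, if_true] at key
        have ht : |t - s| ≤ 0 := (min_le_iff.1 key).resolve_right (not_le.2 hm0)
        have : t = s := by
          have := abs_nonpos_iff.1 ht
          linarith
        subst this
        rfl
      · simp only [if_neg hZY] at key
        exact absurd key (not_le.2 hm0)

noncomputable instance : MetricSpace (Electrification 𝒴) where
  dist_self p := le_antisymm (dist_le_of_hasPath (HasPath.refl p))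
    (le_dist_of_forall fun _ h => h.nonneg)
  dist_comm p q := le_antisymm
    (le_dist_of_forall fun _ h => dist_le_of_hasPath h.symm)
    (le_dist_of_forall fun _ h => dist_le_of_hasPath h.symm)
  dist_triangle p q r := by
    have h1 : ∀ a, HasPath p q a → dist p r - a ≤ dist q r := fun a ha =>
      le_dist_of_forall fun b hb => by linarith [dist_le_of_hasPath (ha.trans hb)]
    have h2 : dist p r - dist q r ≤ dist p q :=
      le_dist_of_forall fun a ha => by linarith [h1 a ha]
    linarith
  eq_of_dist_eq_zero := fun {p q} h => eq_of_dist_eq_zero' p q h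

end metric

section action

variable {G X : Type*} [Group G] [MulAction G X] {𝒴 : Set (Set X)} [InvariantFamily G 𝒴]

/-- The action of `G` on the electrification induced by its action on `X`. -/
instance : SMul G (Electrification 𝒴) where
  smul g p := match p with
    | base x => base (g • x)
    | cone Y hY hne => cone (g • Y) (InvariantFamily.smul_mem g Y hY) hne.smul_set
    | edge Y hY y hy t h0 h1 =>
      edge (g • Y) (InvariantFamily.smul_mem g Y hY) (g • y) (Set.smul_mem_smul_set hy) t h0 h1

theorem smul_base (g : G) (x : X) : g • (base x : Electrification 𝒴) = base (g • x) := rfl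

theorem smul_cone (g : G) (Y : Set X) (hY : Y ∈ 𝒴) (hne : Y.Nonempty) :
    g • (cone Y hY hne : Electrification 𝒴) =
      cone (g • Y) (InvariantFamily.smul_mem g Y hY) hne.smul_set := rfl

theorem smul_edge (g : G) (Y : Set X) (hY : Y ∈ 𝒴) (y : X) (hy : y ∈ Y) (t : ℝ) (h0 : 0 < t)
    (h1 : t < 1 / 2) :
    g • (edge Y hY y hy t h0 h1 : Electrification 𝒴) =
      edge (g • Y) (InvariantFamily.smul_mem g Y hY) (g • y) (Set.smul_mem_smul_set hy)
        t h0 h1 := rfl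

instance : MulAction G (Electrification 𝒴) where
  one_smul p := by cases p <;> simp [smul_base, smul_cone, smul_edge]
  mul_smul g h p := by cases p <;> simp [smul_base, smul_cone, smul_edge, mul_smul]

end action

section isometry

variable {G X : Type*} [Group G] [MetricSpace X] [MulAction G X] [IsIsometricSMul G X]
  {𝒴 : Set (Set X)} [InvariantFamily G 𝒴]

theorem Step.smul (g : G) {p q : Electrification 𝒴} {a : ℝ} (h : Step p q a) :
    Step (g • p) (g • q) a := by
  induction h with
  | inBase x y => rw [← dist_smul g x y]; exact Step.inBase _ _
  | baseEdge => exact Step.baseEdge _ _ _ _ _ _ _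
  | inEdge => exact Step.inEdge _ _ _ _ _ _ _ _ _ _
  | edgeCone => exact Step.edgeCone _ _ _ _ _ _ _ _
  | baseCone Y hY y hy hne =>
    exact Step.baseCone _ _ _ (Set.smul_mem_smul_set hy) _
  | symm _ ih => exact ih.symm

theorem HasPath.smul (g : G) {p q : Electrification 𝒴} {a : ℝ} (h : HasPath p q a) :
    HasPath (g • p) (g • q) a := by
  induction h with
  | refl p => exact HasPath.refl _
  | cons hs _ ih => exact HasPath.cons (hs.smul g) ih

instance : IsIsometricSMul G (Electrification 𝒴) where
  isometry_smul g := Isometry.of_dist_eq fun p q => le_antisymm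
    (le_dist_of_forall fun _ h => dist_le_of_hasPath (h.smul g))
    (le_dist_of_forall fun _ h => dist_le_of_hasPath (by simpa using h.smul g⁻¹))

end isometry

end Electrification

/-- `g` acts loxodromically on `X`: its translation length `lim (1 / n) d(x₀, gⁿ x₀)` (which does
not depend on `x₀`, the action being isometric) exists and is positive. -/
def IsLoxodromic {G X : Type*} [Group G] [MetricSpace X] [MulAction G X] (g : G) : Prop :=
  ∃ τ : ℝ, 0 < τ ∧ ∀ x₀ : X,
    Tendsto (fun n : ℕ => (1 / (n : ℝ)) * dist x₀ (g ^ n • x₀)) atTop (𝓝 τ)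

/-- `γ` is a bi-infinite `(K, c)`-quasigeodesic (not necessarily continuous). -/
def IsQuasigeodesicLine {X : Type*} [MetricSpace X] (K c : ℝ) (γ : ℝ → X) : Prop :=
  ∀ s t : ℝ, K⁻¹ * |s - t| - c ≤ dist (γ s) (γ t) ∧ dist (γ s) (γ t) ≤ K * |s - t| + c

/-- `γ` is a quasi-axis of `g`: a `g`-invariant bi-infinite quasigeodesic. -/
def IsQuasiAxis {G X : Type*} [Group G] [MetricSpace X] [MulAction G X] (g : G) (γ : ℝ → X) :
    Prop :=
  (∃ K c : ℝ, 1 ≤ K ∧ 0 ≤ c ∧ IsQuasigeodesicLine K c γ) ∧ g • Set.range γ = Set.range γ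

/-- `G` acts loxodromically on the subset `Y` of `X`: it contains an element that is loxodromic on
`X` with a quasi-axis contained in a bounded neighbourhood of `Y`. -/
def ActsLoxodromicallyOnSubset (G : Type*) {X : Type*} [Group G] [MetricSpace X] [MulAction G X]
    (Y : Set X) : Prop :=
  ∃ g : G, IsLoxodromic (X := X) g ∧
    ∃ γ : ℝ → X, IsQuasiAxis g γ ∧ ∃ R : ℝ, ∀ t : ℝ, ∃ y ∈ Y, dist (γ t) y ≤ R

/-- `G` acts on `X` with unbounded orbits. -/
def HasUnboundedOrbits (G X : Type*) [Group G] [MetricSpace X] [MulAction G X] : Prop :=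
  ∀ x : X, ¬ Bornology.IsBounded (MulAction.orbit G x)

/-! Coning off can be replaced by the integer-valued path metric `linkDist` of `linkGraph`, which
agrees with the electrified metric on `X` up to a multiplicative factor 2 and an additive 1
(`dist_base_le_linkDist`, `linkDist_le`). The geometric core is `exists_dist_add_dist_le`: geodesics
of `X` do not backtrack in the link graph, up to a uniform error. It follows from exponential
divergence: a link walk of length `N` stays within about `δ log N` of a geodesic of `X`, so a
geodesic far from a shortest link walk would yield a detour that is too short. Hence a bounded
Gromov product in `X` gives a bounded one for `linkDist` (`exists_linkDist_product_le`), and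
`linkDist` is hyperbolic.

For the theorem, let `a` be a high power of the element `g` loxodromic on `X`, and let `h` move `o`
far in `linkDist`. The `g`-orbit of `o` is bounded in `linkDist`, because the quasi-axis lies near
some `Y ∈ 𝒴`. In `X`, however, `a • o` is far from `o` and `a • a • o` and almost between them, so
it remains almost between `h⁻¹ • o` and `a • a • h • o`. Passing to `linkDist`, where `o`, `a • o`
and `a • a • o` are close together, the orbit of `f = a * a * h` makes long steps with small Gromov
products. By the local-to-global principle (`IsHyperbolicDist.mul_le_dist`) it escapes linearly, so
`f` is loxodromic. -/

/-! ### Hyperbolic pseudometrics and the local-to-global principle for discrete quasigeodesics. -/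

/-- The Gromov product `(x | y)_w` of a distance function `d`. -/
noncomputable def gromovProductOf {α : Type*} (d : α → α → ℝ) (w x y : α) : ℝ :=
  (d w x + d w y - d x y) / 2

/-- `d` is a pseudometric satisfying Gromov's four-point condition with constant `δ`. -/
structure IsHyperbolicDist {α : Type*} (d : α → α → ℝ) (δ : ℝ) : Prop where
  self : ∀ x, d x x = 0
  symm : ∀ x y, d x y = d y x
  triangle : ∀ x y z, d x z ≤ d x y + d y z
  delta_nonneg : 0 ≤ δ
  fourPoint : ∀ w x y z,
    min (gromovProductOf d w x y) (gromovProductOf d w y z) - δ ≤ gromovProductOf d w x z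

namespace IsHyperbolicDist

variable {α : Type*} {d : α → α → ℝ} {δ C l : ℝ}

theorem gromovProductOf_comm (h : IsHyperbolicDist d δ) (w x y : α) :
    gromovProductOf d w x y = gromovProductOf d w y x := by
  unfold gromovProductOf
  rw [h.symm x y]
  ring

theorem gromovProductOf_add (h : IsHyperbolicDist d δ) (w x y : α) :
    gromovProductOf d w x y + gromovProductOf d x w y = d w x := by
  unfold gromovProductOf
  rw [h.symm x w]
  ring

theorem dist_sub_le_gromovProductOf (h : IsHyperbolicDist d δ) (w x y : α) :
    d w x - d x y ≤ gromovProductOf d w x y := by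
  have := h.triangle w y x
  unfold gromovProductOf
  rw [h.symm y x] at this
  linarith

/-- If the product of `y` with `x` is large, then `z` has a small product with `y` as soon as it has
a small product with `x`. -/
theorem gromovProductOf_le_of_lt (h : IsHyperbolicDist d δ) {w x y z : α}
    (h1 : gromovProductOf d w x z ≤ C) (h2 : C + δ < gromovProductOf d w x y) :
    gromovProductOf d w y z ≤ C + δ := by
  have := h.fourPoint w x y z
  rcases min_choice (gromovProductOf d w x y) (gromovProductOf d w y z) with h' | h' <;>
    rw [h'] at this <;> linarith

/-- The sequence `x` has steps of length at least `l`, and its Gromov products at consecutive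
triples are at most `C`. -/
structure IsLocalQuasigeodesic (d : α → α → ℝ) (l C : ℝ) (x : ℕ → α) : Prop where
  le_step : ∀ i, l ≤ d (x i) (x (i + 1))
  product_le : ∀ i, gromovProductOf d (x (i + 1)) (x i) (x (i + 2)) ≤ C

theorem IsLocalQuasigeodesic.shift {x : ℕ → α} (hx : IsLocalQuasigeodesic d l C x) (m : ℕ) :
    IsLocalQuasigeodesic d l C fun i => x (m + i) :=
  ⟨fun i => hx.le_step (m + i), fun i => hx.product_le (m + i)⟩

/-- Induction from the far end. A small product at `x 2` forces a large product at `x 1` of `x 2`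
with the endpoint, the two summing to a long step; so the endpoint can replace `x 2` in the local
bound at a cost of `δ`. The error does not accumulate, since each replacement starts again from the
local bound `C`. -/
theorem product_first_le (h : IsHyperbolicDist d δ) (hl : 2 * C + 3 * δ < l) (n : ℕ) :
    ∀ x : ℕ → α, IsLocalQuasigeodesic d l C x →
      gromovProductOf d (x 1) (x 0) (x (n + 2)) ≤ C + δ := by
  have hδ := h.delta_nonneg
  induction n with
  | zero => intro x hx; linarith [hx.product_le 0]
  | succ n ih =>
    intro x hx
    have h1 := ih _ (hx.shift 1)
    have h2 := h.gromovProductOf_add (x 1) (x 2) (x (n + 3))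
    have h3 := hx.le_step 1
    have h4 := hx.product_le 0
    simp only [show 1 + 1 = 2 by norm_num, show 1 + 0 = 1 by norm_num,
      show 1 + (n + 2) = n + 3 by ring] at h1 h2 h3 h4
    rw [h.gromovProductOf_comm] at h4 ⊢
    exact h.gromovProductOf_le_of_lt h4 (by linarith)

theorem product_last_le (h : IsHyperbolicDist d δ) (hl : 2 * C + 3 * δ < l) {x : ℕ → α}
    (hx : IsLocalQuasigeodesic d l C x) (n : ℕ) :
    gromovProductOf d (x (n + 1)) (x 0) (x (n + 2)) ≤ C + δ := by
  have hδ := h.delta_nonneg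
  induction n with
  | zero => linarith [hx.product_le 0]
  | succ n ih =>
    have h2 := h.gromovProductOf_add (x (n + 2)) (x (n + 1)) (x 0)
    have h3 := hx.le_step (n + 1)
    rw [h.gromovProductOf_comm (x (n + 1)), h.symm] at h2
    exact h.gromovProductOf_le_of_lt (hx.product_le (n + 1)) (by linarith)

/-- Combines the bounds looking back and looking forward from `x (m + 1)`. The second replacement
starts from `C + δ` instead of `C`, which is where `3 * δ` in `hl` is needed. -/
theorem product_middle_le (h : IsHyperbolicDist d δ) (hl : 2 * C + 3 * δ < l) {x : ℕ → α}
    (hx : IsLocalQuasigeodesic d l C x) (m n : ℕ) :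
    gromovProductOf d (x (m + 1)) (x 0) (x (m + n + 3)) ≤ C + 2 * δ := by
  have hδ := h.delta_nonneg
  have h1 := h.product_last_le hl hx m
  have h2 := h.product_first_le hl n _ (hx.shift (m + 1))
  have h3 := h.gromovProductOf_add (x (m + 1)) (x (m + 2)) (x (m + n + 3))
  have h4 := hx.le_step (m + 1)
  simp only [show m + 1 + 1 = m + 2 by ring, show m + 1 + 0 = m + 1 by ring,
    show m + 1 + (n + 2) = m + n + 3 by ring] at h2 h3 h4
  rw [h.gromovProductOf_comm] at h1 ⊢
  have := h.gromovProductOf_le_of_lt h1 (y := x (m + n + 3)) (by linarith)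
  linarith

/-- Each new step adds its length minus twice the Gromov product at the last corner, which is at
most `C + δ`. -/
theorem mul_le_dist (h : IsHyperbolicDist d δ) (hl : 2 * C + 3 * δ < l) (hC : 0 ≤ C) {x : ℕ → α}
    (hx : IsLocalQuasigeodesic d l C x) (n : ℕ) :
    n * (l - 2 * C - 2 * δ) ≤ d (x 0) (x n) := by
  have hδ := h.delta_nonneg
  have key : ∀ n : ℕ, (n + 1 : ℕ) * (l - 2 * C - 2 * δ) ≤ d (x 0) (x (n + 1)) := by
    intro n
    induction n with
    | zero => have := hx.le_step 0; push_cast; simp only [zero_add] at *; linarith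
    | succ n ih =>
      have h1 := h.product_last_le hl hx n
      have h2 := hx.le_step (n + 1)
      unfold gromovProductOf at h1
      rw [h.symm (x (n + 1)) (x 0)] at h1
      push_cast at ih ⊢
      simp only [show n + 1 + 1 = n + 2 by ring] at *
      linarith
  cases n with
  | zero => simp [h.self]
  | succ n => exact key n

end IsHyperbolicDist

/-! ### Geodesics and Gromov products in `X`. -/

theorem isHyperbolicDist_dist {X : Type*} [MetricSpace X] (h : IsGromovHyperbolic X) :
    ∃ δ : ℝ, IsHyperbolicDist (dist : X → X → ℝ) δ := by
  obtain ⟨δ, hδ⟩ := h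
  refine ⟨max δ 0, dist_self, dist_comm, dist_triangle, le_max_right _ _, fun w x y z => ?_⟩
  have h1 : min (gromovProductOf dist w x y) (gromovProductOf dist w y z) - δ ≤
    gromovProductOf dist w x z := hδ w x y z
  linarith [le_max_left δ 0]

theorem IsGeodesicSegment.product_eq_zero {X : Type*} [MetricSpace X] {γ : ℝ → X} {x y : X}
    (hγ : IsGeodesicSegment γ x y) {s t u : ℝ} (hs : 0 ≤ s) (hst : s ≤ t) (htu : t ≤ u)
    (hu : u ≤ dist x y) : gromovProductOf dist (γ t) (γ s) (γ u) = 0 := by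
  unfold gromovProductOf
  rw [hγ.2.2 t ⟨by linarith, by linarith⟩ s ⟨by linarith, by linarith⟩,
    hγ.2.2 t ⟨by linarith, by linarith⟩ u ⟨by linarith, by linarith⟩,
    hγ.2.2 s ⟨by linarith, by linarith⟩ u ⟨by linarith, by linarith⟩,
    abs_of_nonneg (by linarith), abs_of_nonpos (by linarith), abs_of_nonpos (by linarith)]
  ring

/-- A geodesic from `x` to `y` contains a point whose distance to `r` is about the Gromov product
`(x | y)_r`. -/
theorem IsGeodesicSegment.exists_near {X : Type*} [MetricSpace X] {δ : ℝ}
    (h : IsHyperbolicDist (dist : X → X → ℝ) δ) {γ : ℝ → X} {x y : X}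
    (hγ : IsGeodesicSegment γ x y) (r : X) :
    ∃ t ∈ Set.Icc 0 (dist x y), dist r (γ t) ≤ gromovProductOf dist r x y + 2 * δ ∧
      dist x (γ t) = gromovProductOf dist x r y ∧ dist y (γ t) = gromovProductOf dist y r x := by
  have h1 := dist_triangle x y r
  have h2 := dist_triangle x r y
  have h3 := dist_triangle r x y
  have h4 := dist_comm x r
  have h5 := dist_comm y r
  have h6 := dist_comm x y
  have ht : gromovProductOf dist x r y ∈ Set.Icc 0 (dist x y) := by
    unfold gromovProductOf
    constructor <;> linarith
  have hx : dist x (γ (gromovProductOf dist x r y)) = gromovProductOf dist x r y := by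
    have := hγ.2.2 0 ⟨le_rfl, dist_nonneg⟩ _ ht
    rwa [hγ.1, zero_sub, abs_neg, abs_of_nonneg ht.1] at this
  have hy : dist y (γ (gromovProductOf dist x r y)) = gromovProductOf dist y r x := by
    have := hγ.2.2 _ ⟨dist_nonneg, le_rfl⟩ _ ht
    rw [hγ.2.1, abs_of_nonneg (by linarith [ht.2])] at this
    rw [this]
    unfold gromovProductOf
    linarith
  refine ⟨_, ht, ?_, hx, hy⟩
  -- At the chosen point `m`, the products `(x | m)_r` and `(m | y)_r` are equal, so the minimum in
  -- the four-point condition is explicit.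
  have := h.fourPoint r x (γ (gromovProductOf dist x r y)) y
  generalize hm : γ (gromovProductOf dist x r y) = m at *
  have e1 : gromovProductOf dist r x m = (dist r m + gromovProductOf dist r x y) / 2 := by
    unfold gromovProductOf at hx ⊢
    rw [hx]; linarith
  have e2 : gromovProductOf dist r m y = (dist r m + gromovProductOf dist r x y) / 2 := by
    unfold gromovProductOf at hy ⊢
    rw [dist_comm m y, hy]; linarith
  rw [e1, e2, min_self] at this
  linarith

/-! ### The link graph, and the logarithmic bound for its walks. -/

/-- The graph on `X` in which two points are adjacent if they are at distance at most `1` or lie in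
a common member of `𝒴`. -/
def linkGraph {X : Type*} [MetricSpace X] (𝒴 : Set (Set X)) : SimpleGraph X where
  Adj x y := x ≠ y ∧ (dist x y ≤ 1 ∨ ∃ Y ∈ 𝒴, x ∈ Y ∧ y ∈ Y)
  symm := ⟨fun x y h => ⟨h.1.symm, h.2.imp (by rw [dist_comm]; exact id)
    fun ⟨Y, hY, h1, h2⟩ => ⟨Y, hY, h2, h1⟩⟩⟩
  loopless := ⟨fun _ h => h.1 rfl⟩

section linkGraph

variable {X : Type*} [MetricSpace X] {𝒴 : Set (Set X)}

theorem linkGraph_dist_le_one {x y : X} (h : dist x y ≤ 1 ∨ ∃ Y ∈ 𝒴, x ∈ Y ∧ y ∈ Y) :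
    (linkGraph 𝒴).dist x y ≤ 1 := by
  by_cases hxy : x = y
  · simp [hxy]
  · exact ((linkGraph 𝒴).dist_eq_one_iff_adj.2 ⟨hxy, h⟩).le

theorem exists_linkGraph_walk (hgeo : IsGeodesicSpace X) (n : ℕ) :
    ∀ x y : X, dist x y ≤ n → ∃ w : (linkGraph 𝒴).Walk x y, w.length ≤ n := by
  induction n with
  | zero =>
    intro x y h
    obtain rfl : x = y := dist_le_zero.1 (by simpa using h)
    exact ⟨.nil, le_rfl⟩
  | succ n ih =>
    intro x y h
    by_cases hn : dist x y ≤ n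
    · obtain ⟨w, hw⟩ := ih x y hn
      exact ⟨w, by omega⟩
    · obtain ⟨γ, hγ⟩ := hgeo x y
      have hL := dist_nonneg (x := x) (y := y)
      push_cast at h
      have h1 : dist x y - n ∈ Set.Icc 0 (dist x y) :=
        ⟨by linarith, by linarith [n.cast_nonneg (α := ℝ)]⟩
      have d1 := hγ.2.2 0 ⟨le_rfl, hL⟩ _ h1
      have d2 := hγ.2.2 _ h1 _ ⟨hL, le_rfl⟩
      rw [hγ.1, zero_sub, abs_neg, abs_of_nonneg h1.1] at d1
      rw [hγ.2.1, abs_of_nonpos (by linarith [h1.2])] at d2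
      obtain ⟨w, hw⟩ := ih _ y (by linarith : dist (γ (dist x y - n)) y ≤ n)
      have hadj : (linkGraph 𝒴).Adj x (γ (dist x y - n)) := by
        refine ⟨fun he => ?_, Or.inl (by linarith)⟩
        rw [← he, dist_self] at d1
        linarith
      exact ⟨.cons hadj w, Nat.succ_le_succ hw⟩

theorem linkGraph_connected (hgeo : IsGeodesicSpace X) [Nonempty X] :
    (linkGraph 𝒴).Connected :=
  ⟨fun x y => by
    obtain ⟨n, hn⟩ := exists_nat_ge (dist x y)
    exact ⟨(exists_linkGraph_walk hgeo n x y hn).choose⟩⟩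

theorem linkGraph_dist_le (hgeo : IsGeodesicSpace X) (x y : X) :
    ((linkGraph 𝒴).dist x y : ℝ) ≤ dist x y + 1 := by
  obtain ⟨w, hw⟩ := exists_linkGraph_walk (𝒴 := 𝒴) hgeo _ x y (Nat.le_ceil _)
  have h1 : ((linkGraph 𝒴).dist x y : ℝ) ≤ (⌈dist x y⌉₊ : ℝ) := by
    exact_mod_cast ((linkGraph 𝒴).dist_le w).trans hw
  linarith [Nat.ceil_lt_add_one (dist_nonneg (x := x) (y := y))]

/-- A walk of length at most `2 ^ k` from `x` to `y` passes close to any point with a small Gromov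
product with respect to `x` and `y`. -/
theorem exists_mem_support_dist_le [Nonempty X] (hgeo : IsGeodesicSpace X) {δ Q : ℝ}
    (h : IsHyperbolicDist (dist : X → X → ℝ) δ) (hQ : ∀ Y ∈ 𝒴, IsQuasiconvexSubset Q Y)
    (r : X) (k : ℕ) :
    ∀ (x y : X) (w : (linkGraph 𝒴).Walk x y), w.length ≤ 2 ^ k →
      ∃ v ∈ w.support, ((linkGraph 𝒴).dist r v : ℝ) ≤
        gromovProductOf dist r x y + k * δ + (2 * δ + |Q| + 2) := by
  have hδ := h.delta_nonneg
  have hQ0 := abs_nonneg Q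
  induction k with
  | zero =>
    intro x y w hw
    refine ⟨x, w.start_mem_support, ?_⟩
    have h0 := linkGraph_dist_le (𝒴 := 𝒴) hgeo r x
    have hgp := h.dist_sub_le_gromovProductOf r x y
    have hxy : x = y ∨ (linkGraph 𝒴).Adj x y := by
      rcases w with _ | ⟨ha, w⟩
      · exact Or.inl rfl
      · rcases w with _ | ⟨hb, w⟩
        · exact Or.inr ha
        · simp at hw
    simp only [Nat.cast_zero, zero_mul, add_zero]
    rcases hxy with rfl | ⟨-, hxy | ⟨Y, hY, hx, hy⟩⟩
    · rw [dist_self] at hgp; linarith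
    · linarith
    -- The only use of quasiconvexity: a geodesic across `Y` passes near `r`, hence so does a point
    -- `z` of `Y`, and `z` is within one link step of `x`.
    · obtain ⟨γ, hγ⟩ := hgeo x y
      obtain ⟨t, ht, hrt, -⟩ := hγ.exists_near h r
      obtain ⟨z, hz, htz⟩ := hQ Y hY x hx y hy γ hγ t ht
      have h1 := linkGraph_dist_le (𝒴 := 𝒴) hgeo r z
      have h2 := linkGraph_dist_le_one (𝒴 := 𝒴) (Or.inr ⟨Y, hY, hz, hx⟩)
      have h3 : ((linkGraph 𝒴).dist r x : ℝ) ≤ (linkGraph 𝒴).dist r z + 1 := by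
        exact_mod_cast ((linkGraph_connected hgeo).dist_triangle).trans
          (Nat.add_le_add_left h2 _)
      linarith [dist_triangle r (γ t) z, le_abs_self Q]
  | succ k ih =>
    intro x y w hw
    rw [pow_succ] at hw
    have hsub1 : (w.take (2 ^ k)).support ⊆ w.support := (w.isSubwalk_take _).support_subset
    have hsub2 : (w.drop (2 ^ k)).support ⊆ w.support := (w.isSubwalk_drop _).support_subset
    -- Cut the walk at its vertex number `2 ^ k`. One half has endpoints whose product at `r` is at
    -- most `δ` larger, so `k` halvings cost `k * δ`.
    have key := h.fourPoint r x (w.getVert (2 ^ k)) y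
    push_cast
    rcases min_choice (gromovProductOf dist r x (w.getVert (2 ^ k)))
      (gromovProductOf dist r (w.getVert (2 ^ k)) y) with h' | h' <;> rw [h'] at key
    · obtain ⟨v, hv, hd⟩ := ih _ _ (w.take (2 ^ k)) (by simp [SimpleGraph.Walk.take_length])
      exact ⟨v, hsub1 hv, by linarith⟩
    · obtain ⟨v, hv, hd⟩ := ih _ _ (w.drop (2 ^ k))
        (by simp only [SimpleGraph.Walk.drop_length]; omega)
      exact ⟨v, hsub2 hv, by linarith⟩

end linkGraph

/-! ### Shortest walks and detours in a connected graph. -/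

namespace SimpleGraph

variable {V : Type*} {G : SimpleGraph V}

theorem dist_add_dist_of_mem_support (hconn : G.Connected) {x y s : V} {w : G.Walk x y}
    (hw : w.length = G.dist x y) (hs : s ∈ w.support) : G.dist x s + G.dist s y = G.dist x y := by
  classical
  have h1 := G.dist_le (w.takeUntil s hs)
  have h2 := G.dist_le (w.dropUntil s hs)
  have h3 := congrArg Walk.length (w.take_spec hs)
  rw [Walk.length_append] at h3
  have h4 := hconn.dist_triangle (u := x) (v := s) (w := y)
  omega

/-- Two points of a shortest walk are joined by a shortest walk inside it. -/
theorem exists_walk_support_subset {x y s t : V} {w : G.Walk x y}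
    (hw : w.length = G.dist x y) (hs : s ∈ w.support) (ht : t ∈ w.support) :
    ∃ v : G.Walk s t, v.length = G.dist s t ∧ v.support ⊆ w.support := by
  classical
  have ht' : t ∈ ((w.takeUntil s hs).append (w.dropUntil s hs)).support := by rwa [w.take_spec hs]
  rcases (Walk.mem_support_append_iff _ _).1 ht' with h | h
  · have hsub := (Walk.isSubwalk_dropUntil _ h).trans (w.isSubwalk_takeUntil hs)
    refine ⟨((w.takeUntil s hs).dropUntil t h).reverse, ?_, ?_⟩
    · rw [Walk.length_reverse, length_eq_dist_of_subwalk hw hsub, dist_comm]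
    · simpa [Walk.support_reverse] using hsub.support_subset
  · have hsub := (Walk.isSubwalk_takeUntil _ h).trans (w.isSubwalk_dropUntil hs)
    exact ⟨_, length_eq_dist_of_subwalk hw hsub, hsub.support_subset⟩

/-- A sequence with steps of length at most one, stopped when it reaches distance `D` from its
start. -/
theorem exists_dist_le_of_steps (hconn : G.Connected) (u : ℕ → V)
    (hu : ∀ i, G.dist (u i) (u (i + 1)) ≤ 1) (D n : ℕ) :
    ∃ i ≤ n, G.dist (u i) (u 0) ≤ D ∧ (i = n ∨ G.dist (u i) (u 0) = D) := by
  induction n with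
  | zero => exact ⟨0, le_rfl, by simp, Or.inl rfl⟩
  | succ n ih =>
    obtain ⟨i, hi, h1, h2⟩ := ih
    by_cases hD : G.dist (u i) (u 0) = D
    · exact ⟨i, by omega, h1, Or.inr hD⟩
    · obtain rfl := h2.resolve_right hD
      have h3 := hconn.dist_triangle (u := u (i + 1)) (v := u i) (w := u 0)
      have h4 := hu i
      rw [dist_comm] at h4
      exact ⟨i + 1, le_rfl, by omega, Or.inl rfl⟩

/-- A sequence with steps of length at most one ending in `S` and staying `D`-close to `S` contains
a point, not too far from its start `r`, which can be joined to `S` away from `r`. -/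
theorem exists_detour (hconn : G.Connected) {S : Set V} (u : ℕ → V)
    (hu : ∀ i, G.dist (u i) (u (i + 1)) ≤ 1) {D n : ℕ} (hn : u n ∈ S)
    (hD : ∀ i ≤ n, ∃ s ∈ S, G.dist (u i) s ≤ D) (hS : ∀ s ∈ S, D ≤ G.dist s (u 0)) :
    ∃ i ≤ n, ∃ s ∈ S, ∃ w : G.Walk (u i) s, w.length ≤ D ∧ G.dist (u i) (u 0) ≤ 2 * D ∧
      ∀ v ∈ w.support, D ≤ G.dist v (u 0) := by
  obtain ⟨i, hi, h1, h2⟩ := exists_dist_le_of_steps hconn u hu (2 * D) n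
  by_cases hin : i = n
  · subst hin
    exact ⟨i, le_rfl, u i, hn, .nil, by simp, h1, by simpa using hS _ hn⟩
  · have h2 := h2.resolve_left hin
    obtain ⟨s, hs, hsD⟩ := hD i hi
    obtain ⟨w, hw⟩ := hconn.exists_walk_length_eq_dist (u i) s
    refine ⟨i, hi, s, hs, w, by omega, h1, fun v hv => ?_⟩
    have h3 := dist_add_dist_of_mem_support hconn hw hv
    have h4 := hconn.dist_triangle (u := u i) (v := v) (w := u 0)
    omega

end SimpleGraph

/-! ### Geodesics of `X` in the link graph, and hyperbolicity of the link distance. -/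

/-- The quantitative contradiction behind the detour argument: a walk of length `8 * D` passes
within `K + k * δ` of the geodesic with `k` about `log₂ D`, which is eventually below `D`. -/
theorem exists_forall_log_bound (K δ : ℝ) :
    ∃ D₀ : ℕ, ∀ D ≥ D₀, ∃ k : ℕ, 8 * D ≤ 2 ^ k ∧ K + k * δ < D := by
  have h : Tendsto (fun m : ℕ => K * ((m : ℝ) ^ 0 / 2 ^ m) + δ * ((m : ℝ) ^ 1 / 2 ^ m) +
      4 * δ * ((m : ℝ) ^ 0 / 2 ^ m)) atTop (𝓝 (K * 0 + δ * 0 + 4 * δ * 0)) :=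
    (((tendsto_pow_const_div_const_pow_of_one_lt 0 one_lt_two).const_mul K).add
      ((tendsto_pow_const_div_const_pow_of_one_lt 1 one_lt_two).const_mul δ)).add
      ((tendsto_pow_const_div_const_pow_of_one_lt 0 one_lt_two).const_mul (4 * δ))
  obtain ⟨m₀, hm₀⟩ := eventually_atTop.1 (h.eventually (gt_mem_nhds (by norm_num : K * 0 + δ * 0 + 4 * δ * 0 < 1)))
  refine ⟨2 ^ m₀, fun D hD => ⟨Nat.log 2 D + 4, ?_, ?_⟩⟩
  · have := Nat.lt_pow_succ_log_self one_lt_two D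
    rw [pow_succ] at this
    rw [pow_add]
    omega
  · have hD0 : D ≠ 0 := by have := Nat.two_pow_pos m₀; omega
    have h1 := hm₀ _ (Nat.le_log_of_pow_le one_lt_two hD)
    have h2 : (2 : ℝ) ^ Nat.log 2 D ≤ D := by exact_mod_cast Nat.pow_log_le_self 2 hD0
    have h3 : (0 : ℝ) < 2 ^ Nat.log 2 D := by positivity
    refine lt_of_lt_of_le ?_ h2
    rw [← div_lt_one h3]
    refine lt_of_eq_of_lt ?_ h1
    push_cast
    field_simp
    ring

section linkGraph

variable {X : Type*} [MetricSpace X] {𝒴 : Set (Set X)}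

/-- If a geodesic of `X` is `D`-close to a shortest walk of the link graph with the same endpoints
and `D` is large, then it is `(D - 1)`-close to it. -/
theorem IsGeodesicSegment.exists_mem_support_dist_lt [Nonempty X] (hgeo : IsGeodesicSpace X)
    {δ Q : ℝ} (h : IsHyperbolicDist (dist : X → X → ℝ) δ)
    (hQ : ∀ Y ∈ 𝒴, IsQuasiconvexSubset Q Y) {x y : X} {γ : ℝ → X} (hγ : IsGeodesicSegment γ x y)
    {w : (linkGraph 𝒴).Walk x y} (hw : w.length = (linkGraph 𝒴).dist x y) {D k : ℕ}
    (hk : 8 * D ≤ 2 ^ k) (hDk : 2 * δ + |Q| + 2 + k * δ < D)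
    (hD : ∀ t ∈ Set.Icc 0 (dist x y), ∃ s ∈ w.support, (linkGraph 𝒴).dist (γ t) s ≤ D) :
    ∀ t ∈ Set.Icc 0 (dist x y), ∃ s ∈ w.support, (linkGraph 𝒴).dist (γ t) s < D := by
  intro t ht
  by_contra! hcon
  have hconn := linkGraph_connected (𝒴 := 𝒴) hgeo
  obtain ⟨n, hn⟩ := exists_nat_ge (dist x y)
  have hstep : ∀ f : ℕ → ℝ, (∀ i, f i ∈ Set.Icc 0 (dist x y)) → (∀ i, |f i - f (i + 1)| ≤ 1) →
      ∀ i, (linkGraph 𝒴).dist (γ (f i)) (γ (f (i + 1))) ≤ 1 := fun f hf hf' i =>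
    linkGraph_dist_le_one (Or.inl (by rw [hγ.2.2 _ (hf i) _ (hf (i + 1))]; exact hf' i))
  have hL : (0 : ℝ) ≤ dist x y := dist_nonneg
  have detour : ∀ f : ℕ → ℝ, f 0 = t → (∀ i, f i ∈ Set.Icc 0 (dist x y)) →
      (∀ i, |f i - f (i + 1)| ≤ 1) → γ (f n) ∈ w.support →
      ∃ i ≤ n, ∃ s ∈ w.support, ∃ v : (linkGraph 𝒴).Walk (γ (f i)) s, v.length ≤ D ∧
        (linkGraph 𝒴).dist (γ (f i)) (γ t) ≤ 2 * D ∧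
        ∀ z ∈ v.support, D ≤ (linkGraph 𝒴).dist z (γ t) := by
    intro f hf0 hf hf' hfn
    have := SimpleGraph.exists_detour hconn (S := {z | z ∈ w.support}) (fun i => γ (f i))
      (hstep f hf hf') (D := D) hfn (fun i _ => hD _ (hf i)) (by
        intro s hs
        rw [SimpleGraph.dist_comm, hf0]
        exact hcon s hs)
    rwa [hf0] at this
  have e0 : ∀ i : ℕ, (0 : ℝ) ≤ i := fun i => i.cast_nonneg
  -- Leave `γ t` along the geodesic in both directions by unit steps, clamped at the endpoints,
  -- which lie on `w`.
  obtain ⟨i, -, s, hs, v, hv, hi, hvD⟩ := detour (fun i => max (t - i) 0)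
    (by simp [ht.1]) (fun i => ⟨le_max_right _ _, max_le (by linarith [ht.2, e0 i]) hL⟩)
    (fun i => (abs_max_sub_max_le_abs _ _ _).trans (by push_cast; ring_nf; simp))
    (by rw [max_eq_right (by linarith [ht.2]), hγ.1]; exact w.start_mem_support)
  obtain ⟨j, -, s', hs', v', hv', hj, hvD'⟩ := detour (fun i => min (t + i) (dist x y))
    (by simp [ht.2]) (fun i => ⟨le_min (by linarith [ht.1, e0 i]) hL, min_le_right _ _⟩)
    (fun i => (abs_min_sub_min_le_max _ _ _ _).trans (by push_cast; ring_nf; simp))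
    (by rw [min_eq_right (by linarith [ht.1]), hγ.2.1]; exact w.end_mem_support)
  obtain ⟨m, hm, hms⟩ := SimpleGraph.exists_walk_support_subset hw hs hs'
  -- The two side walks have length at most `D` each, and the part on `w` at most `D + 2D + 2D + D`:
  -- in total `8 * D`.
  have hlen : ((v.append m).append v'.reverse).length ≤ 2 ^ k := by
    rw [SimpleGraph.Walk.length_append, SimpleGraph.Walk.length_append,
      SimpleGraph.Walk.length_reverse, hm]
    have h1 := hconn.dist_triangle (u := s) (v := γ (max (t - i) 0)) (w := s')
    have h2 := hconn.dist_triangle (u := γ (max (t - i) 0)) (v := γ t) (w := s')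
    have h3 := hconn.dist_triangle (u := γ t) (v := γ (min (t + j) (dist x y))) (w := s')
    have h4 := (linkGraph 𝒴).dist_le v
    have h5 := (linkGraph 𝒴).dist_le v'
    rw [SimpleGraph.dist_comm] at h4
    rw [SimpleGraph.dist_comm (u := γ t) (v := γ (min (t + j) (dist x y)))] at h3
    omega
  obtain ⟨z, hz, hzr⟩ := exists_mem_support_dist_le hgeo h hQ (γ t) k _ _ _ hlen
  have hgp := hγ.product_eq_zero (le_max_right (t - i) 0)
    (max_le (by linarith [e0 i]) ht.1 : max (t - i) 0 ≤ t)
    (le_min (by linarith [e0 j]) ht.2 : t ≤ min (t + j) (dist x y)) (min_le_right _ _)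
  rw [hgp] at hzr
  have hzD : D ≤ (linkGraph 𝒴).dist (γ t) z := by
    rw [SimpleGraph.Walk.mem_support_append_iff, SimpleGraph.Walk.mem_support_append_iff,
      SimpleGraph.Walk.support_reverse, List.mem_reverse] at hz
    rcases hz with (hz | hz) | hz
    · rw [SimpleGraph.dist_comm]; exact hvD z hz
    · exact hcon z (hms hz)
    · rw [SimpleGraph.dist_comm]; exact hvD' z hz
  have : (D : ℝ) ≤ (linkGraph 𝒴).dist (γ t) z := by exact_mod_cast hzD
  linarith

/-- Geodesics of `X` have, up to a uniform additive error, additive distances in the link graph. -/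
theorem exists_dist_add_dist_le [Nonempty X] (hgeo : IsGeodesicSpace X)
    {δ Q : ℝ} (h : IsHyperbolicDist (dist : X → X → ℝ) δ)
    (hQ : ∀ Y ∈ 𝒴, IsQuasiconvexSubset Q Y) :
    ∃ D₀ : ℕ, ∀ (x y : X) (γ : ℝ → X), IsGeodesicSegment γ x y → ∀ t ∈ Set.Icc 0 (dist x y),
      (linkGraph 𝒴).dist x (γ t) + (linkGraph 𝒴).dist (γ t) y ≤ (linkGraph 𝒴).dist x y + D₀ := by
  have hconn := linkGraph_connected (𝒴 := 𝒴) hgeo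
  obtain ⟨D₀, hD₀⟩ := exists_forall_log_bound (2 * δ + |Q| + 2) δ
  refine ⟨2 * D₀, fun x y γ hγ => ?_⟩
  obtain ⟨w, hw⟩ := hconn.exists_walk_length_eq_dist x y
  -- Descent: some finite closeness bound, depending on the endpoints, always holds, and it can be
  -- lowered by one as long as it exceeds the uniform threshold `D₀`.
  have key : ∀ n : ℕ, (∀ t ∈ Set.Icc 0 (dist x y), ∃ s ∈ w.support,
      (linkGraph 𝒴).dist (γ t) s ≤ D₀ + n) → ∀ t ∈ Set.Icc 0 (dist x y), ∃ s ∈ w.support,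
      (linkGraph 𝒴).dist (γ t) s ≤ D₀ := by
    intro n
    induction n with
    | zero => exact id
    | succ n ih =>
      intro hn
      obtain ⟨k, hk, hk'⟩ := hD₀ (D₀ + (n + 1)) (by omega)
      refine ih fun t ht => ?_
      obtain ⟨s, hs, hs'⟩ := hγ.exists_mem_support_dist_lt hgeo h hQ hw hk hk' hn t ht
      exact ⟨s, hs, by omega⟩
  obtain ⟨n, hn⟩ := exists_nat_ge (dist x y + 1)
  intro t ht
  obtain ⟨s, hs, hs'⟩ := key n (fun t ht => ⟨x, w.start_mem_support, by
    have h1 := linkGraph_dist_le (𝒴 := 𝒴) hgeo (γ t) x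
    have h2 := hγ.2.2 t ht 0 ⟨le_rfl, dist_nonneg⟩
    rw [hγ.1, sub_zero, abs_of_nonneg ht.1] at h2
    have : ((linkGraph 𝒴).dist (γ t) x : ℝ) ≤ n := by linarith [ht.2]
    have : (linkGraph 𝒴).dist (γ t) x ≤ n := by exact_mod_cast this
    omega⟩) t ht
  have h1 := SimpleGraph.dist_add_dist_of_mem_support hconn hw hs
  have h2 := hconn.dist_triangle (u := x) (v := s) (w := γ t)
  have h3 := hconn.dist_triangle (u := γ t) (v := s) (w := y)
  rw [SimpleGraph.dist_comm (u := s) (v := γ t)] at h2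
  omega

/-- The distance of the link graph, as a real number. -/
noncomputable def linkDist (𝒴 : Set (Set X)) (x y : X) : ℝ := (linkGraph 𝒴).dist x y

theorem linkDist_triangle [Nonempty X] (hgeo : IsGeodesicSpace X) (x y z : X) :
    linkDist 𝒴 x z ≤ linkDist 𝒴 x y + linkDist 𝒴 y z := by
  unfold linkDist
  exact_mod_cast (linkGraph_connected hgeo).dist_triangle

theorem linkDist_comm (x y : X) : linkDist 𝒴 x y = linkDist 𝒴 y x := by
  unfold linkDist
  rw [SimpleGraph.dist_comm]

/-- A bound on a Gromov product in `X` implies a bound on it for the link distance. -/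
theorem exists_linkDist_product_le [Nonempty X] (hgeo : IsGeodesicSpace X)
    {δ Q : ℝ} (h : IsHyperbolicDist (dist : X → X → ℝ) δ)
    (hQ : ∀ Y ∈ 𝒴, IsQuasiconvexSubset Q Y) (c : ℝ) :
    ∃ C : ℝ, 0 ≤ C ∧ ∀ r x y : X, gromovProductOf dist r x y ≤ c →
      gromovProductOf (linkDist 𝒴) r x y ≤ C := by
  obtain ⟨D₀, hD₀⟩ := exists_dist_add_dist_le hgeo h hQ
  refine ⟨max (D₀ / 2 + (c + 2 * δ + 1)) 0, le_max_right _ _, fun r x y hr =>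
    le_max_of_le_left ?_⟩
  obtain ⟨γ, hγ⟩ := hgeo x y
  obtain ⟨t, ht, hrt, -⟩ := hγ.exists_near h r
  have h1 : linkDist 𝒴 x (γ t) + linkDist 𝒴 (γ t) y ≤ linkDist 𝒴 x y + D₀ := by
    unfold linkDist
    exact_mod_cast hD₀ x y γ hγ t ht
  have h2 : linkDist 𝒴 r (γ t) ≤ dist r (γ t) + 1 := linkGraph_dist_le hgeo r (γ t)
  have h3 := linkDist_triangle (𝒴 := 𝒴) hgeo r (γ t) x
  have h4 := linkDist_triangle (𝒴 := 𝒴) hgeo r (γ t) y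
  rw [linkDist_comm (γ t) x] at h3
  unfold gromovProductOf at *
  linarith

/-- Let `m` be a near-projection of `w` to a geodesic `[x, z]` of `X`. The products at `m` of `w`
with `x` and with `z` are at most `δ`, and so is one of `(x | y)_m`, `(y | z)_m`. All these bounds
transfer to `linkDist`, where they give the four-point condition at `w`. -/
theorem exists_isHyperbolicDist_linkDist [Nonempty X] (hgeo : IsGeodesicSpace X)
    {δ Q : ℝ} (h : IsHyperbolicDist (dist : X → X → ℝ) δ)
    (hQ : ∀ Y ∈ 𝒴, IsQuasiconvexSubset Q Y) :
    ∃ δ' : ℝ, IsHyperbolicDist (linkDist 𝒴) δ' := by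
  have hδ := h.delta_nonneg
  obtain ⟨C, hC0, hC⟩ := exists_linkDist_product_le hgeo h hQ δ
  -- The error is only `2 * C` because the distance from `w` to `x` (or to `z`) cancels in the
  -- difference of the two products compared.
  refine ⟨2 * C, fun x => by simp [linkDist], linkDist_comm, linkDist_triangle hgeo,
    by linarith, fun w x y z => ?_⟩
  obtain ⟨γ, hγ⟩ := hgeo x z
  obtain ⟨t, ht, hwm, hxm, hzm⟩ := hγ.exists_near h w
  have hxz := hγ.product_eq_zero le_rfl ht.1 ht.2 le_rfl
  rw [hγ.1, hγ.2.1] at hxz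
  generalize γ t = m at *
  have hwx : gromovProductOf dist m w x ≤ δ := by
    unfold gromovProductOf at *
    rw [dist_comm m w, dist_comm m x]
    linarith [dist_comm x w]
  have hwz : gromovProductOf dist m w z ≤ δ := by
    unfold gromovProductOf at *
    rw [dist_comm m w, dist_comm m z]
    linarith [dist_comm z w, dist_comm x z]
  have k1 := hC _ _ _ hwx
  have k2 := hC _ _ _ hwz
  have hm := h.fourPoint m x y z
  rw [hxz] at hm
  rw [tsub_le_iff_right]
  have t1 := linkDist_triangle (𝒴 := 𝒴) hgeo w m x
  have t2 := linkDist_triangle (𝒴 := 𝒴) hgeo w m y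
  have t3 := linkDist_triangle (𝒴 := 𝒴) hgeo w m z
  have t4 := linkDist_triangle (𝒴 := 𝒴) hgeo x m z
  have s1 := linkDist_comm (𝒴 := 𝒴) w m
  have s2 := linkDist_comm (𝒴 := 𝒴) x m
  rcases min_choice (gromovProductOf dist m x y) (gromovProductOf dist m y z) with h' | h' <;>
    rw [h'] at hm
  · refine (min_le_left _ _).trans ?_
    have := hC m x y (by linarith)
    unfold gromovProductOf at *
    linarith
  · refine (min_le_right _ _).trans ?_
    have := hC m y z (by linarith)
    unfold gromovProductOf at *
    linarith

end linkGraph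

/-! ### Comparison of the link distance with the electrified distance. -/

section comparison

variable {X : Type*} [MetricSpace X] {𝒴 : Set (Set X)}

open Electrification in
theorem dist_base_le_linkDist [Nonempty X] (hgeo : IsGeodesicSpace X) (x y : X) :
    dist (base x : Electrification 𝒴) (base y) ≤ linkDist 𝒴 x y := by
  have key : ∀ {x y : X} (w : (linkGraph 𝒴).Walk x y),
      dist (base x : Electrification 𝒴) (base y) ≤ w.length := by
    intro x y w
    induction w with
    | nil => simp
    | @cons u v y hadj w ih =>
      have h1 : dist (base u : Electrification 𝒴) (base v) ≤ 1 := by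
        rcases hadj.2 with h | ⟨Y, hY, hu, hv⟩
        · exact (dist_le_of_hasPath (Step.inBase u v).hasPath).trans h
        · have := dist_le_of_hasPath ((Step.baseCone Y hY u hu ⟨u, hu⟩).hasPath.trans
            (Step.baseCone Y hY v hv ⟨u, hu⟩).symm.hasPath)
          linarith
      have h2 := dist_triangle (base u : Electrification 𝒴) (base v) (base y)
      rw [SimpleGraph.Walk.length_cons]
      push_cast
      linarith
  obtain ⟨w, hw⟩ := (linkGraph_connected (𝒴 := 𝒴) hgeo).exists_walk_length_eq_dist x y
  unfold linkDist
  rw [← hw]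
  exact key w

open Electrification in
/-- A `1`-Lipschitz function on `X` which varies by at most `1` on each member of `𝒴` is
`1`-Lipschitz for the electrified distance. -/
theorem sub_le_dist_base (f : X → ℝ) (hf : ∀ x y, f x - f y ≤ dist x y)
    (hf' : ∀ Y ∈ 𝒴, ∀ x ∈ Y, ∀ y ∈ Y, f x - f y ≤ 1) (x y : X) :
    f x - f y ≤ dist (base y : Electrification 𝒴) (base x) := by
  -- The values of `f` on `Y` lie in an interval of length 1 starting at the infimum. Its midpoint,
  -- as value at the cone vertex, allows linear interpolation with slope at most 1 on edges of
  -- length `1 / 2`.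
  let c : Set X → ℝ := fun Y => (⨅ y : Y, f y) + 1 / 2
  have hc : ∀ Y ∈ 𝒴, ∀ y ∈ Y, |c Y - f y| ≤ 1 / 2 := by
    intro Y hY y hy
    have : Nonempty Y := ⟨⟨y, hy⟩⟩
    have h1 : f y - 1 ≤ ⨅ z : Y, f z := le_ciInf fun z => by linarith [hf' Y hY y hy z z.2]
    have h2 : ⨅ z : Y, f z ≤ f y := ciInf_le
      ⟨f y - 1, by rintro _ ⟨z, rfl⟩; linarith [hf' Y hY y hy z z.2]⟩ (⟨y, hy⟩ : Y)
    rw [abs_le]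
    constructor <;> simp only [c] <;> linarith
  let F : Electrification 𝒴 → ℝ := fun r => match r with
    | base z => f z
    | cone Y _ _ => c Y
    | edge Y _ y _ t _ _ => f y + 2 * t * (c Y - f y)
  refine sub_le_dist F (fun p q a hs => ?_) (base y) (base x)
  induction hs with
  | inBase u v =>
    have h1 := hf u v
    have h2 := hf v u
    rw [dist_comm] at h2
    rw [abs_le]
    constructor <;> simp only [F] <;> linarith
  | baseEdge Y hY y hy t h0 h1 =>
    have := hc Y hY y hy
    simp only [F]
    rw [sub_add_cancel_left, abs_neg, abs_mul, abs_of_pos (by linarith)]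
    nlinarith
  | inEdge Y hY y hy s hs0 hs1 t ht0 ht1 =>
    have := hc Y hY y hy
    simp only [F]
    rw [show f y + 2 * s * (c Y - f y) - (f y + 2 * t * (c Y - f y)) =
      2 * ((s - t) * (c Y - f y)) by ring, abs_mul, abs_mul, abs_two]
    nlinarith [abs_nonneg (s - t)]
  | edgeCone Y hY y hy t h0 h1 hne =>
    have := hc Y hY y hy
    simp only [F]
    rw [show f y + 2 * t * (c Y - f y) - c Y = -((1 - 2 * t) * (c Y - f y)) by ring, abs_neg,
      abs_mul, abs_of_pos (by linarith)]
    nlinarith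
  | baseCone Y hY y hy hne =>
    have := hc Y hY y hy
    rw [abs_sub_comm] at this
    exact this
  | symm _ ih => rwa [abs_sub_comm]

theorem linkDist_le (hgeo : IsGeodesicSpace X) (x y : X) :
    linkDist 𝒴 x y ≤ 2 * dist (Electrification.base x : Electrification 𝒴)
      (Electrification.base y) + 1 := by
  have : Nonempty X := ⟨x⟩
  -- A 1-Lipschitz regularization of half the link distance to `y`. The factor `1 / 2` absorbs the
  -- additive 1 in `linkGraph_dist_le` and keeps the variation on each `Y` at most 1.
  let f : X → ℝ := fun u => ⨅ z : X, (linkDist 𝒴 z y / 2 + dist u z)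
  have hN : ∀ u v : X, 0 ≤ linkDist 𝒴 u v := fun u v => Nat.cast_nonneg _
  have hle : ∀ u z, f u ≤ linkDist 𝒴 z y / 2 + dist u z := fun u z =>
    ciInf_le (f := fun z : X => linkDist 𝒴 z y / 2 + dist u z) ⟨0, by
      rintro _ ⟨v, rfl⟩; have := hN v y; positivity⟩ z
  have h1 : ∀ u v, f u - f v ≤ dist u v := fun u v => by
    rw [sub_le_comm]
    exact le_ciInf fun z => by linarith [hle u z, dist_triangle u v z]
  have h2 : ∀ Y ∈ 𝒴, ∀ u ∈ Y, ∀ v ∈ Y, f u - f v ≤ 1 := fun Y hY u hu v hv => by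
    rw [sub_le_comm]
    refine le_ciInf fun z => ?_
    have a1 := hle u u
    have a2 := linkDist_triangle (𝒴 := 𝒴) hgeo u v y
    have a3 := linkDist_triangle (𝒴 := 𝒴) hgeo v z y
    have a4 : linkDist 𝒴 v z ≤ dist v z + 1 := linkGraph_dist_le hgeo v z
    have a5 : linkDist 𝒴 u v ≤ 1 := by
      unfold linkDist
      exact_mod_cast linkGraph_dist_le_one (𝒴 := 𝒴) (Or.inr ⟨Y, hY, hu, hv⟩)
    rw [dist_self] at a1
    linarith [dist_nonneg (x := v) (y := z)]
  have h3 := sub_le_dist_base f h1 h2 x y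
  have h4 : f y ≤ 0 := by
    have := hle y y
    simpa [linkDist] using this
  have h5 : linkDist 𝒴 x y / 2 - 1 / 2 ≤ f x := le_ciInf fun z => by
    have a3 := linkDist_triangle (𝒴 := 𝒴) hgeo x z y
    have a4 : linkDist 𝒴 x z ≤ dist x z + 1 := linkGraph_dist_le hgeo x z
    linarith [dist_nonneg (x := x) (y := z)]
  rw [dist_comm]
  linarith

theorem linkDist_smul {G : Type*} [Group G] [MulAction G X] [IsIsometricSMul G X]
    [InvariantFamily G 𝒴] (hgeo : IsGeodesicSpace X) (g : G) (x y : X) :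
    linkDist 𝒴 (g • x) (g • y) = linkDist 𝒴 x y := by
  have : Nonempty X := ⟨x⟩
  have key : ∀ (g : G) (x y : X),
      (linkGraph 𝒴).dist (g • x) (g • y) ≤ (linkGraph 𝒴).dist x y := by
    intro g x y
    let φ : linkGraph 𝒴 →g linkGraph 𝒴 := ⟨fun x => g • x, fun {u v} huv =>
      ⟨fun he => huv.1 (smul_left_cancel g he), huv.2.imp (by rw [dist_smul]; exact id)
        fun ⟨Y, hY, hu, hv⟩ => ⟨g • Y, InvariantFamily.smul_mem g Y hY,
          Set.smul_mem_smul_set hu, Set.smul_mem_smul_set hv⟩⟩⟩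
    obtain ⟨w, hw⟩ := (linkGraph_connected (𝒴 := 𝒴) hgeo).exists_walk_length_eq_dist x y
    rw [← hw, ← w.length_map φ]
    exact (linkGraph 𝒴).dist_le _
  unfold linkDist
  refine congrArg Nat.cast (le_antisymm (key g x y) ?_)
  simpa using key g⁻¹ (g • x) (g • y)

end comparison

/-! ### Loxodromic elements, linear growth and orbits. -/

section loxodromic

variable {G Z : Type*} [Group G] [MulAction G Z]

theorem isLocalQuasigeodesic_orbit {d : Z → Z → ℝ} (hd : ∀ (g : G) x y, d (g • x) (g • y) = d x y)
    (g : G) (o : Z) :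
    IsHyperbolicDist.IsLocalQuasigeodesic d (d o (g • o)) (gromovProductOf d (g • o) o (g • g • o))
      fun i => g ^ i • o := by
  constructor <;> intro i
  · rw [pow_succ, mul_smul, hd]
  · simp only [pow_succ, mul_smul]
    unfold gromovProductOf
    rw [hd, hd, hd (g ^ i) o (g • g • o)]

variable [MetricSpace Z] [IsIsometricSMul G Z]

/-- Fekete's lemma provides the limit at `o`; changing the base point alters the displacement by at
most `2 * dist x o`, which is negligible after division by `n`. -/
theorem isLoxodromic_of_linear_growth {g : G} {o : Z} {ε c : ℝ} (hε : 0 < ε)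
    (h : ∀ n : ℕ, n * ε - c ≤ dist o (g ^ n • o)) : IsLoxodromic (X := Z) g := by
  have hsub : Subadditive fun n : ℕ => dist o (g ^ n • o) := fun m n => by
    have := dist_triangle o (g ^ m • o) (g ^ (m + n) • o)
    rwa [pow_add, mul_smul, dist_smul, ← mul_smul, ← pow_add] at this
  have hlim := hsub.tendsto_lim ⟨0, by rintro _ ⟨n, rfl⟩; dsimp only; positivity⟩
  have hconst : ∀ a : ℝ, Tendsto (fun n : ℕ => a / (n : ℝ)) atTop (𝓝 0) := fun a =>
    tendsto_const_div_atTop_nhds_zero_nat a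
  refine ⟨hsub.lim, hε.trans_le ?_, fun x => ?_⟩
  · have h1 : Tendsto (fun n : ℕ => ε - c / (n : ℝ)) atTop (𝓝 (ε - 0)) :=
      tendsto_const_nhds.sub (hconst c)
    rw [sub_zero] at h1
    refine le_of_tendsto_of_tendsto h1 hlim ?_
    filter_upwards [eventually_gt_atTop 0] with n hn
    have hn' : (0 : ℝ) < n := by exact_mod_cast hn
    rw [le_div_iff₀ hn', sub_mul, div_mul_cancel₀ _ hn'.ne']
    linarith [h n]
  · have h1 : Tendsto (fun n : ℕ => (dist x (g ^ n • x) - dist o (g ^ n • o)) / (n : ℝ))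
        atTop (𝓝 0) := by
      refine squeeze_zero_norm (fun n => ?_) (hconst (2 * dist x o))
      rw [norm_div, Real.norm_natCast]
      refine div_le_div_of_nonneg_right ?_ n.cast_nonneg
      have a1 := dist_triangle4 x o (g ^ n • o) (g ^ n • x)
      have a2 := dist_triangle4 o x (g ^ n • x) (g ^ n • o)
      rw [dist_smul, dist_comm o x] at *
      rw [Real.norm_eq_abs, abs_le]
      constructor <;> linarith
    have h2 := hlim.add h1
    rw [add_zero] at h2
    refine h2.congr fun n => ?_
    ring

/-- Arbitrarily large powers `a` of a loxodromic isometry have `(o | a² o)_{a o}` bounded. -/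
theorem IsLoxodromic.exists_pow_product_le {g : G} (hg : IsLoxodromic (X := Z) g) {δ : ℝ}
    (h : IsHyperbolicDist (dist : Z → Z → ℝ) δ) (o : Z) :
    ∃ c : ℝ, ∀ M : ℝ, ∃ n : ℕ, M ≤ dist o (g ^ n • o) ∧
      gromovProductOf dist (g ^ n • o) o (g ^ n • g ^ n • o) ≤ c := by
  have hδ := h.delta_nonneg
  obtain ⟨τ, hτ, hlim⟩ := hg
  -- Otherwise each doubling of the exponent would add at most `3 * δ`, so the displacement of `g ^
  -- 2 ^ j` would be linear in `j`, against positive translation length. The inequality says exactly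
  -- that the orbit of `g ^ N` satisfies the local-to-global hypothesis.
  obtain ⟨N, hN⟩ : ∃ N : ℕ, dist o (g ^ N • o) + 3 * δ < dist o (g ^ (2 * N) • o) := by
    by_contra! hcon
    have hb : ∀ j : ℕ, dist o (g ^ 2 ^ j • o) ≤ dist o (g • o) + j * (3 * δ) := by
      intro j
      induction j with
      | zero => simp
      | succ j ih =>
        have := hcon (2 ^ j)
        rw [← pow_succ'] at this
        push_cast
        linarith
    have h1 := (hlim o).comp (tendsto_pow_atTop_atTop_of_one_lt (one_lt_two (α := ℕ)))
    have h2 := ((tendsto_pow_const_div_const_pow_of_one_lt 0 (one_lt_two (α := ℝ))).const_mul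
      (dist o (g • o))).add ((tendsto_pow_const_div_const_pow_of_one_lt 1
        (one_lt_two (α := ℝ))).const_mul (3 * δ))
    have h3 := le_of_tendsto_of_tendsto' h1 h2 fun j => by
      have := hb j
      have hp : (0 : ℝ) < 2 ^ j := by positivity
      simp only [Function.comp, pow_zero, pow_one]
      push_cast
      rw [← mul_div_assoc, ← mul_div_assoc, ← add_div, one_div, inv_mul_eq_div]
      exact div_le_div_of_nonneg_right (by linarith) hp.le
    simp only [mul_zero, add_zero] at h3
    linarith
  have hx := isLocalQuasigeodesic_orbit (d := (dist : Z → Z → ℝ)) dist_smul (g ^ N) o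
  have hC0 : 0 ≤ gromovProductOf dist (g ^ N • o) o (g ^ N • g ^ N • o) := by
    have := dist_triangle_left o (g ^ N • g ^ N • o) (g ^ N • o)
    unfold gromovProductOf
    linarith
  have hl : 2 * gromovProductOf dist (g ^ N • o) o (g ^ N • g ^ N • o) + 3 * δ <
      dist o (g ^ N • o) := by
    unfold gromovProductOf
    rw [dist_smul, dist_comm _ o, ← mul_smul, ← pow_add]
    rw [two_mul] at hN
    linarith
  refine ⟨gromovProductOf dist (g ^ N • o) o (g ^ N • g ^ N • o) + 2 * δ, fun M => ?_⟩
  obtain ⟨k, hk⟩ := exists_nat_ge (M / (dist o (g ^ N • o) -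
    2 * gromovProductOf dist (g ^ N • o) o (g ^ N • g ^ N • o) - 2 * δ))
  -- Powers of `g ^ N` are used because `product_middle_le` bounds the product at every interior
  -- orbit point by the same constant; the shift by 2 makes the middle point an admissible index.
  refine ⟨N * (k + 2), ?_, ?_⟩
  · have h1 := h.mul_le_dist hl hC0 hx (k + 2)
    rw [div_le_iff₀ (by linarith)] at hk
    rw [pow_zero, one_smul] at h1
    rw [pow_mul]
    push_cast at h1
    linarith
  · have h1 := h.product_middle_le hl hx (k + 1) k
    rw [pow_zero, one_smul, show k + 1 + k + 3 = (k + 2) + (k + 2) by ring,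
      show k + 1 + 1 = k + 2 by ring, pow_add _ (k + 2), mul_smul, ← pow_mul] at h1
    exact h1

end loxodromic

/-! ### Construction of the loxodromic element. -/

section main

variable {G X : Type*} [Group G] [MetricSpace X] [MulAction G X] {𝒴 : Set (Set X)}

/-- The orbit of a point under a loxodromic element with a quasi-axis near a member of `𝒴` is
bounded in the electrified metric. -/
theorem IsQuasiAxis.exists_linkDist_le (hgeo : IsGeodesicSpace X) {g : G} {γ : ℝ → X}
    (hγ : IsQuasiAxis g γ) {Y : Set X} (hY : Y ∈ 𝒴) {R : ℝ}
    (hR : ∀ t : ℝ, ∃ y ∈ Y, dist (γ t) y ≤ R) (n : ℕ) :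
    linkDist 𝒴 (γ 0) (g ^ n • γ 0) ≤ 2 * R + 3 := by
  have : Nonempty X := ⟨γ 0⟩
  have hmem : g ^ n • γ 0 ∈ Set.range γ := by
    induction n with
    | zero => simp
    | succ n ih =>
      rw [pow_succ', mul_smul, ← hγ.2]
      exact Set.smul_mem_smul_set ih
  obtain ⟨t, ht⟩ := hmem
  rw [← ht]
  obtain ⟨y, hy, hyR⟩ := hR 0
  obtain ⟨z, hz, hzR⟩ := hR t
  have h1 := linkDist_triangle (𝒴 := 𝒴) hgeo (γ 0) y (γ t)
  have h2 := linkDist_triangle (𝒴 := 𝒴) hgeo y z (γ t)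
  have h3 : linkDist 𝒴 (γ 0) y ≤ dist (γ 0) y + 1 := linkGraph_dist_le hgeo _ _
  have h4 : linkDist 𝒴 (γ t) z ≤ dist (γ t) z + 1 := linkGraph_dist_le hgeo _ _
  have h5 : linkDist 𝒴 y z ≤ 1 := by
    unfold linkDist
    exact_mod_cast linkGraph_dist_le_one (𝒴 := 𝒴) (Or.inr ⟨Y, hY, hy, hz⟩)
  rw [linkDist_comm] at h4
  linarith

theorem HasUnboundedOrbits.exists_lt_linkDist [InvariantFamily G 𝒴] (hgeo : IsGeodesicSpace X)
    (hunb : HasUnboundedOrbits G (Electrification 𝒴)) (o : X) (L : ℝ) :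
    ∃ h : G, L < linkDist 𝒴 o (h • o) := by
  have : Nonempty X := ⟨o⟩
  by_contra! hcon
  refine hunb (.base o) ((Metric.isBounded_iff_subset_closedBall (.base o)).2 ⟨L, ?_⟩)
  rintro _ ⟨h, rfl⟩
  rw [Metric.mem_closedBall, dist_comm]
  exact (dist_base_le_linkDist hgeo o (h • o)).trans (hcon h)

/-- If `p` and `q` are much closer to `x` and `y` than `r` is, then `(p | q)_r` is bounded in terms
of `(x | y)_r`. -/
theorem IsHyperbolicDist.product_le_of_near {Z : Type*} {d : Z → Z → ℝ} {δ c : ℝ}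
    (h : IsHyperbolicDist d δ) {r x y p q : Z} (hr : gromovProductOf d r x y ≤ c)
    (hp : c + 2 * δ + d x p < d r x) (hq : c + 2 * δ + d y q < d r y) :
    gromovProductOf d r p q ≤ c + 2 * δ := by
  have hδ := h.delta_nonneg
  have h1 := h.gromovProductOf_le_of_lt hr (y := p)
    (by linarith [h.dist_sub_le_gromovProductOf r x p])
  rw [h.gromovProductOf_comm] at h1
  have h2 := h.gromovProductOf_le_of_lt h1 (y := q)
    (by linarith [h.dist_sub_le_gromovProductOf r y q])
  rw [h.gromovProductOf_comm]
  linarith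

end main

theorem mainTheorem6 {G X : Type*} [Group G] [MetricSpace X] [MulAction G X] [IsIsometricSMul G X]
    (hgeo : IsGeodesicSpace X) (hhyp : IsGromovHyperbolic X)
    (𝒴 : Set (Set X)) [InvariantFamily G 𝒴] (hqc : UniformlyQuasiconvex 𝒴)
    (hdiam : Metric.ediam (Set.univ : Set (Electrification 𝒴)) = ⊤)
    (hunb : HasUnboundedOrbits G (Electrification 𝒴))
    (hlox : ∃ Y ∈ 𝒴, ActsLoxodromicallyOnSubset G Y) :
    ∃ g : G, IsLoxodromic (X := Electrification 𝒴) g := by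
  obtain ⟨δ, hδ⟩ := isHyperbolicDist_dist hhyp
  obtain ⟨Q, hQ⟩ := hqc
  obtain ⟨Y, hY, g, hg, γ, hγ, R, hR⟩ := hlox
  have : Nonempty X := ⟨γ 0⟩
  have hD := hγ.exists_linkDist_le (𝒴 := 𝒴) hgeo hY hR
  generalize γ 0 = o at hD
  generalize 2 * R + 3 = D at hD
  obtain ⟨c, hc⟩ := hg.exists_pow_product_le hδ o
  obtain ⟨C, hC0, hC⟩ := exists_linkDist_product_le hgeo hδ hQ (c + 2 * δ)
  obtain ⟨δ', hδ'⟩ := exists_isHyperbolicDist_linkDist (𝒴 := 𝒴) hgeo hδ hQ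
  -- The estimates `e1` to `e4` need only `4 * D + 2 * C + 3 * δ'`; since `D ≥ 0`, the bound with `6
  -- * D` suffices. `h` is fixed before the power of `g`, whose displacement in `X` must exceed that
  -- of `h`.
  obtain ⟨h, hh⟩ := hunb.exists_lt_linkDist hgeo o (6 * D + 2 * C + 3 * δ')
  obtain ⟨n, hn, hnc⟩ := hc (c + 2 * δ + dist o (h • o) + 1)
  have hsm : ∀ (g : G) (x y : X), linkDist 𝒴 (g • x) (g • y) = linkDist 𝒴 x y := linkDist_smul hgeo
  have hsm' : ∀ (g : G) (x y : X), linkDist 𝒴 (g⁻¹ • x) y = linkDist 𝒴 x (g • y) := fun g x y => by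
    rw [← hsm g, smul_inv_smul]
  have ds' : ∀ (g : G) (x y : X), dist (g⁻¹ • x) y = dist x (g • y) := fun g x y => by
    rw [← dist_smul g, smul_inv_smul]
  have hDa := hD n
  have hDaa := hD (n + n)
  rw [pow_add, mul_smul] at hDaa
  generalize g ^ n = a at *
  have hX := hδ.product_le_of_near (p := h⁻¹ • o) (q := a • a • h • o) hnc
    (by rw [dist_comm o, ds', dist_comm (a • o)]; linarith)
    (by rw [dist_smul, dist_smul, dist_smul]; linarith)
  have hP := hC _ _ _ hX
  have tri := linkDist_triangle (𝒴 := 𝒴) hgeo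
  have comm := linkDist_comm (𝒴 := 𝒴)
  have e1 : linkDist 𝒴 o (h • o) - D ≤ linkDist 𝒴 (a • o) (h⁻¹ • o) := by
    have := tri o (a • o) (h⁻¹ • o)
    rw [comm o (h⁻¹ • o), hsm' h o o] at this
    linarith
  have e2 : linkDist 𝒴 o (h • o) - D ≤ linkDist 𝒴 (a • o) (a • a • h • o) := by
    have t := tri (a • o) o (a • h • o)
    rw [hsm a o (h • o), comm (a • o) o] at t
    rw [hsm]
    linarith
  -- The element `a * a * h` sends `h⁻¹ • o` to `a • a • o`, which is `D`-close to `o`; so `h⁻¹ • o`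
  -- is `D`-close to the preimage of `o`.
  have e3 : linkDist 𝒴 (h⁻¹ • o) (a • a • h • o) ≤
      D + linkDist 𝒴 o ((a * a * h) • (a * a * h) • o) := by
    have t := tri (h⁻¹ • o) ((a * a * h)⁻¹ • o) (a • a • h • o)
    have t1 : linkDist 𝒴 (h⁻¹ • o) ((a * a * h)⁻¹ • o) = linkDist 𝒴 o (a • a • o) := by
      rw [mul_inv_rev, mul_smul, hsm, comm, hsm', mul_smul]
    have t2 := hsm' (a * a * h) o (a • a • h • o)
    simp only [mul_smul] at *
    linarith
  have e4 : linkDist 𝒴 o ((a * a * h) • o) ≤ D + linkDist 𝒴 o (h • o) := by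
    have t := tri o (a • a • o) (a • a • h • o)
    rw [hsm, hsm] at t
    simp only [mul_smul]
    linarith
  have e5 : linkDist 𝒴 o (h • o) - D ≤ linkDist 𝒴 o ((a * a * h) • o) := by
    have t := tri (a • a • o) o (a • a • h • o)
    rw [hsm, hsm, comm _ o] at t
    simp only [mul_smul]
    linarith
  -- Equivalently, the square of `a * a * h` moves `o` by more than `3 * δ'` beyond the displacement
  -- of `a * a * h`.
  have hl : 2 * gromovProductOf (linkDist 𝒴) ((a * a * h) • o) o ((a * a * h) • (a * a * h) • o) +
      3 * δ' < linkDist 𝒴 o ((a * a * h) • o) := by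
    unfold gromovProductOf at hP ⊢
    rw [hsm, comm _ o]
    linarith
  have hx := isLocalQuasigeodesic_orbit (d := linkDist 𝒴) hsm (a * a * h) o
  have hgp : 0 ≤ gromovProductOf (linkDist 𝒴) ((a * a * h) • o) o
      ((a * a * h) • (a * a * h) • o) := by
    have := tri o ((a * a * h) • o) ((a * a * h) • (a * a * h) • o)
    unfold gromovProductOf
    rw [comm _ o]
    linarith
  have hgrow := hδ'.mul_le_dist hl hgp hx
  have hδ0 := hδ'.delta_nonneg
  -- Halving the growth rate and taking `c = 1 / 2` accounts for `linkDist ≤ 2 * dist + 1`.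
  refine ⟨a * a * h, isLoxodromic_of_linear_growth (o := .base o) (c := 1 / 2)
    (ε := (linkDist 𝒴 o ((a * a * h) • o) - 2 * gromovProductOf (linkDist 𝒴) ((a * a * h) • o) o
      ((a * a * h) • (a * a * h) • o) - 2 * δ') / 2) (by linarith) fun m => ?_⟩
  have h1 := hgrow m
  rw [pow_zero, one_smul] at h1
  have h2 := linkDist_le (𝒴 := 𝒴) hgeo o ((a * a * h) ^ m • o)
  rw [Electrification.smul_base]
  linarith
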